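/- For a matrix $W\in\mathbb{R}^{k\times d}$ with rows $w_1,\dots,w_k$ let $f(x,W)=\sum_{j=1}^{k}\langle w_j,x\rangle^2$ be the two-layer network with quadratic activation and $k$ hidden nodes. There is an absolute constant $C>0$ such that the following holds for all integers $d,n\ge 1$ and $k\ge 0$ with $n\ge d\log d$ and all real $M,L\ge 0$. Let $P$ be a probability distribution of pairs $(x,y)$ in which the input is standard Gaussian, $x\sim N(0,I_d)$, while the label $y$ (with values in any measurable space) may depend on $x$ in an arbitrary way. Let $\ell(u,y)$ be a real-valued loss that is measurable in $y$ and $L$-Lipschitz in its first argument $u\in\mathbb{R}$, with $\ell(0,y)$ integrable. Let $(x_1,y_1),\dots,(x_n,y_n)$ be an i.i.d. sample from $P$, and put $$L_{tr}(W)=\frac1n\sum_{i=1}^n \ell\bigl(f(x_i,W),y_i\bigr),\qquad L_{te}(W)=\mathbb{E}_{(x,y)\sim P}\,\ell\bigl(f(x,W),y\bigr).$$ Then, with probability at least $$1-\frac{C}{d}\left(1+\frac{\operatorname{Var}(\ell(0,y))}{L^2M^4}\right),$$ every $W\in\mathbb{R}^{k\times d}$ with $\|W\|_F\le M$ satisfies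 $$L_{te}(W)-L_{tr}(W)\le C\,L\,M^2\sqrt{\frac dn}.$$ (Here $\operatorname{Var}(\ell(0,y))\in[0,\infty]$, and if $LM=0$ the quotient is read as $0$ when the variance is $0$ and as $\infty$ otherwise.) In particular the failure probability is at most $C/d$ when $\ell(0,y)$ does not depend on $y$, as for the logistic loss with labels $y=\pm1$. Neither the bound nor the probability depends on $k$. -/

import Mathlib

open MeasureTheory ProbabilityTheory
open scoped NNReal ENNReal

namespace QuadNet

/-- The two-layer network with `k` hidden nodes, quadratic activation `z ↦ z ^ 2` and all
second-layer weights equal to `1`: `f (x, W) = ∑ j, ⟨w_j, x⟩ ^ 2`, where `w_j` is row `j` of `W`. -/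
def network {d k : ℕ} (x : EuclideanSpace ℝ (Fin d)) (W : Matrix (Fin k) (Fin d) ℝ) : ℝ :=
  ∑ j, (∑ i, W j i * x i) ^ 2

/-- The Frobenius norm of a real matrix. -/
noncomputable def frobNorm {d k : ℕ} (W : Matrix (Fin k) (Fin d) ℝ) : ℝ :=
  Real.sqrt (∑ j, ∑ i, W j i ^ 2)

/-- `frobBall k d M` is the set of `k × d` matrices of Frobenius norm at most `M`. -/
def frobBall (k d : ℕ) (M : ℝ) : Set (Matrix (Fin k) (Fin d) ℝ) :=
  {W | frobNorm W ≤ M}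

/-- The empirical (training) loss of the weights `W` on the sample `S`. -/
noncomputable def trainLoss {d k n : ℕ} {Y : Type*} (ℓ : ℝ → Y → ℝ)
    (S : Fin n → EuclideanSpace ℝ (Fin d) × Y) (W : Matrix (Fin k) (Fin d) ℝ) : ℝ :=
  (1 / (n : ℝ)) * ∑ i, ℓ (network (S i).1 W) (S i).2

/-- The population (test) loss of the weights `W` under the data distribution `P`. -/
noncomputable def testLoss {d k : ℕ} {Y : Type*} [MeasurableSpace Y] (ℓ : ℝ → Y → ℝ)
    (P : Measure (EuclideanSpace ℝ (Fin d) × Y)) (W : Matrix (Fin k) (Fin d) ℝ) : ℝ :=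
  ∫ z, ℓ (network z.1 W) z.2 ∂P

end QuadNet

/-! The loss splits as `ℓ 0 y` plus the excess `ℓ (f(x, W)) y - ℓ 0 y`. The first term does not
involve `W`, and Chebyshev's inequality for its sample mean gives the variance term of the failure
probability.

The excess is bounded by `L * f(x, W)` and is `L`-Lipschitz in `f(x, W)`, so symmetrization and
contraction at the level of exponential moments replace it by `ε * f(x, W)` with a random sign `ε`,
whatever the labels are. Both are done for one observation, uniformly over shifts
(`lintegral_iSup_ennexp_symmetrization`), and then carried to the whole sample by Fubini
(`lintegral_pi_iSup_ennexp_le`).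

The signed sum `∑ i, ε i * f(x i, W)` is the sum over the rows of `W` of one quadratic form in `d`
variables. It is at most `‖W‖_F ^ 2` times the norm of that form, which is why `k` disappears. A net
of `5 ^ d` points controls the norm (`abs_quadForm_le_of_net`), and at each point the sum has
explicit Gaussian exponential moments. At scale `√(d/n)` these contribute `exp (d/4)`; Markov's
inequality at level `exp (4 * d)` beats the size of the net. -/

namespace QuadNet

open scoped RealInnerProductSpace

/-! ### Exponential moments of suprema: contraction and symmetrization -/

/-- The real exponential with values in `ℝ≥0∞`. -/
noncomputable def ennexp (x : ℝ) : ℝ≥0∞ := ENNReal.ofReal (Real.exp x)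

lemma measurable_ennexp : Measurable ennexp :=
  (Real.measurable_exp).ennreal_ofReal

lemma _root_.Measurable.ennexp {α : Type*} [MeasurableSpace α] {f : α → ℝ} (hf : Measurable f) :
    Measurable fun x => ennexp (f x) :=
  measurable_ennexp.comp hf

lemma ennexp_mono : Monotone ennexp := fun _ _ h =>
  ENNReal.ofReal_le_ofReal (Real.exp_le_exp.2 h)

lemma ennexp_add (x y : ℝ) : ennexp (x + y) = ennexp x * ennexp y := by
  rw [ennexp, Real.exp_add, ENNReal.ofReal_mul (Real.exp_pos x).le]; rfl

lemma ennexp_ne_zero (x : ℝ) : ennexp x ≠ 0 := by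
  simp [ennexp, Real.exp_pos]

lemma ennexp_ne_top (x : ℝ) : ennexp x ≠ ∞ := ENNReal.ofReal_ne_top

/-- A majorization inequality: expand `(exp I - exp x) * (exp I - exp y) ≥ 0`, bound `exp (x + y)`
by `exp (I + J)`, and divide by `exp I`. -/
lemma exp_add_exp_le {x y I J : ℝ} (hx : x ≤ I) (hy : y ≤ I) (h : x + y ≤ I + J) :
    Real.exp x + Real.exp y ≤ Real.exp I + Real.exp J := by
  have hI := Real.exp_pos I
  have h1 : Real.exp x * Real.exp y ≤ Real.exp I * Real.exp J := by
    rw [← Real.exp_add, ← Real.exp_add]; exact Real.exp_le_exp.2 h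
  have h2 := mul_nonneg (sub_nonneg.2 (Real.exp_le_exp.2 hx)) (sub_nonneg.2 (Real.exp_le_exp.2 hy))
  have h3 : Real.exp I * (Real.exp x + Real.exp y) ≤ Real.exp I * (Real.exp I + Real.exp J) := by
    nlinarith
  exact le_of_mul_le_mul_left h3 hI

/-- One coordinate of the Ledoux–Talagrand contraction principle for exponential moments, when the
dominating functions are nonnegative. -/
lemma iSup_ennexp_contraction {T : Type*} (a φ ψ : T → ℝ) (h₀ : ∀ t, |φ t| ≤ ψ t)
    (h : ∀ s t, |φ s - φ t| ≤ |ψ s - ψ t|) :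
    (⨆ t, ennexp (a t + φ t)) + (⨆ t, ennexp (a t - φ t)) ≤
      (⨆ t, ennexp (a t + ψ t)) + ⨆ t, ennexp (a t - ψ t) := by
  cases isEmpty_or_nonempty T
  · simp
  refine ENNReal.iSup_add_iSup_le fun s t => ?_
  have hs := abs_le.1 (h₀ s)
  have ht := abs_le.1 (h₀ t)
  have key : ∀ I J : ℝ, a s + φ s ≤ I → a t - φ t ≤ I → a s + φ s + (a t - φ t) ≤ I + J →
      ennexp (a s + φ s) + ennexp (a t - φ t) ≤ ennexp I + ennexp J := by
    intro I J h1 h2 h3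
    simp only [ennexp]
    rw [← ENNReal.ofReal_add (Real.exp_pos _).le (Real.exp_pos _).le,
      ← ENNReal.ofReal_add (Real.exp_pos _).le (Real.exp_pos _).le]
    exact ENNReal.ofReal_le_ofReal (exp_add_exp_le h1 h2 h3)
  have hst := (le_abs_self _).trans (h s t)
  have hI : ennexp (max (a s + ψ s) (a t + ψ t)) ≤ ⨆ t, ennexp (a t + ψ t) := by
    rcases max_choice (a s + ψ s) (a t + ψ t) with e | e <;> rw [e]
    · exact le_iSup (fun t => ennexp (a t + ψ t)) s
    · exact le_iSup (fun t => ennexp (a t + ψ t)) t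
  have m1 := le_max_left (a s + ψ s) (a t + ψ t)
  have m2 := le_max_right (a s + ψ s) (a t + ψ t)
  -- The larger of `ψ s`, `ψ t` takes the plus sign: if `ψ t ≤ ψ s`, then `φ s - φ t ≤ ψ s - ψ t`
  -- bounds the sum of exponents by `(a s + ψ s) + (a t - ψ t)`. Replacing `a s + ψ s` by the
  -- maximum makes `I` dominate each exponent separately, by `|φ| ≤ ψ`.
  rcases le_total (ψ t) (ψ s) with c | c
  · rw [abs_of_nonneg (sub_nonneg.2 c)] at hst
    exact (key _ (a t - ψ t) (by linarith) (by linarith) (by linarith)).trans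
      (add_le_add hI (le_iSup (fun t => ennexp (a t - ψ t)) t))
  · rw [abs_of_nonpos (sub_nonpos.2 c)] at hst
    exact (key _ (a s - ψ s) (by linarith) (by linarith) (by linarith)).trans
      (add_le_add hI (le_iSup (fun t => ennexp (a t - ψ t)) s))

/-- Jensen's inequality for the exponential, without integrability of the exponential. -/
lemma ennexp_integral_le {Z : Type*} [MeasurableSpace Z] (P : Measure Z) [IsProbabilityMeasure P]
    {h : Z → ℝ} (hh : Integrable h P) : ennexp (∫ z, h z ∂P) ≤ ∫⁻ z, ennexp (h z) ∂P := by
  by_cases hi : Integrable (fun z => Real.exp (h z)) P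
  · have := convexOn_exp.map_integral_le (μ := P) Real.continuous_exp.continuousOn isClosed_univ
      (by simp) hh hi
    simp only [ennexp]
    rw [← ofReal_integral_eq_lintegral_ofReal hi (by filter_upwards with z using (Real.exp_pos _).le)]
    exact ENNReal.ofReal_le_ofReal this
  · have hm : AEStronglyMeasurable (fun z => Real.exp (h z)) P :=
      Real.continuous_exp.comp_aestronglyMeasurable hh.1
    have : ∫⁻ z, ennexp (h z) ∂P = ∞ := by
      by_contra hne
      refine hi ⟨hm, ?_⟩
      rw [hasFiniteIntegral_iff_ofReal (by filter_upwards with z using (Real.exp_pos _).le)]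
      exact lt_top_iff_ne_top.2 hne
    rw [this]; exact le_top

/-- The law of a uniformly random sign. -/
noncomputable def rademacher : Measure ℝ :=
  (2⁻¹ : ℝ≥0∞) • (Measure.dirac 1 + Measure.dirac (-1))

instance : IsProbabilityMeasure rademacher := by
  constructor
  simp only [rademacher, Measure.smul_apply, Measure.add_apply, measure_univ, smul_eq_mul]
  rw [one_add_one_eq_two, ENNReal.inv_mul_cancel two_ne_zero ENNReal.ofNat_ne_top]

lemma lintegral_rademacher (h : ℝ → ℝ≥0∞) :
    ∫⁻ e, h e ∂rademacher = 2⁻¹ * (h 1 + h (-1)) := by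
  simp [rademacher, lintegral_add_measure, mul_add]

/-- Symmetrization and contraction for a single observation. -/
lemma lintegral_iSup_ennexp_symmetrization {T Z : Type*} [Countable T] [MeasurableSpace Z]
    (P : Measure Z) [IsProbabilityMeasure P] (a : T → ℝ) (g ψ : T → Z → ℝ)
    (hg : ∀ t, Measurable (g t)) (hψ : ∀ t, Measurable (ψ t)) (hi : ∀ t, Integrable (g t) P)
    (h₀ : ∀ t z, |g t z| ≤ ψ t z) (h : ∀ s t z, |g s z - g t z| ≤ |ψ s z - ψ t z|) :
    ∫⁻ z, ⨆ t, ennexp (a t + (∫ z', g t z' ∂P - g t z)) ∂P ≤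
      ∫⁻ z, ⨆ t, ennexp (a t + 2 * z.2 * ψ t z.1) ∂(P.prod rademacher) := by
  have mA : Measurable fun z => ⨆ t, ennexp (a t + 2 * g t z) :=
    Measurable.iSup fun t => (((hg t).const_mul 2).const_add _).ennexp
  have mB : Measurable fun z => ⨆ t, ennexp (a t - 2 * g t z) :=
    Measurable.iSup fun t => (((hg t).const_mul 2).const_sub _).ennexp
  set A : ℝ≥0∞ := ∫⁻ z, ⨆ t, ennexp (a t + 2 * g t z) ∂P with hA
  -- The exponent `a + m - g`, with `m` the mean of `g`, is the midpoint of `a + 2 * m` and `a - 2 *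
  -- g`. Convexity of `exp` separates the two, and Jensen's inequality absorbs the mean into `A`.
  have step : ∀ z, (⨆ t, ennexp (a t + (∫ z', g t z' ∂P - g t z))) ≤
      2⁻¹ * (A + ⨆ t, ennexp (a t - 2 * g t z)) := by
    intro z
    refine iSup_le fun t => ?_
    have h1 : ennexp (a t + 2 * ∫ z', g t z' ∂P) ≤ A := by
      have := ennexp_integral_le P (h := fun z => a t + 2 * g t z)
        ((integrable_const _).add ((hi t).const_mul 2))
      rw [integral_add (integrable_const _) ((hi t).const_mul 2), integral_const_mul] at this
      simp only [integral_const, probReal_univ, smul_eq_mul, one_mul] at this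
      exact this.trans (lintegral_mono fun z => le_iSup (fun t => ennexp (a t + 2 * g t z)) t)
    refine le_trans ?_ (mul_le_mul_right (add_le_add h1
      (le_iSup (fun t => ennexp (a t - 2 * g t z)) t)) _)
    set m := ∫ z', g t z' ∂P
    have e2 : (2⁻¹ : ℝ≥0∞) = ENNReal.ofReal (1 / 2) := by
      rw [one_div, ENNReal.ofReal_inv_of_pos two_pos, ENNReal.ofReal_ofNat]
    simp only [ennexp]
    rw [e2, ← ENNReal.ofReal_add (Real.exp_pos _).le (Real.exp_pos _).le,
      ← ENNReal.ofReal_mul (by norm_num)]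
    refine ENNReal.ofReal_le_ofReal ?_
    have := exp_add_exp_le (x := a t + (m - g t z)) (y := a t + (m - g t z))
      (I := max (a t + 2 * m) (a t - 2 * g t z)) (J := min (a t + 2 * m) (a t - 2 * g t z))
    have hs := max_add_min (a t + 2 * m) (a t - 2 * g t z)
    have hl := le_max_left (a t + 2 * m) (a t - 2 * g t z)
    have hr := le_max_right (a t + 2 * m) (a t - 2 * g t z)
    have h3 := this (by linarith) (by linarith) (by linarith)
    rcases le_total (a t + 2 * m) (a t - 2 * g t z) with c | c
    · rw [max_eq_right c, min_eq_left c] at h3; linarith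
    · rw [max_eq_left c, min_eq_right c] at h3; linarith
  calc ∫⁻ z, ⨆ t, ennexp (a t + (∫ z', g t z' ∂P - g t z)) ∂P
      ≤ ∫⁻ z, 2⁻¹ * (A + ⨆ t, ennexp (a t - 2 * g t z)) ∂P := lintegral_mono step
    _ = ∫⁻ z, 2⁻¹ * ((⨆ t, ennexp (a t + 2 * g t z)) + ⨆ t, ennexp (a t - 2 * g t z)) ∂P := by
        rw [lintegral_const_mul _ (mB.const_add _), lintegral_const_mul _ (by exact mA.add mB),
          lintegral_add_left measurable_const, lintegral_add_left mA]
        simp [hA]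
    _ ≤ ∫⁻ z, 2⁻¹ * ((⨆ t, ennexp (a t + 2 * ψ t z)) + ⨆ t, ennexp (a t - 2 * ψ t z)) ∂P := by
        refine lintegral_mono fun z => mul_le_mul_right (iSup_ennexp_contraction a
          (fun t => 2 * g t z) (fun t => 2 * ψ t z) (fun t => ?_) (fun s t => ?_)) _
        · rw [abs_mul, abs_two]; linarith [h₀ t z]
        · rw [← mul_sub, ← mul_sub, abs_mul, abs_mul, abs_two]; linarith [h s t z]
    _ = _ := by
        have mψ : Measurable fun z : Z × ℝ => ⨆ t, ennexp (a t + 2 * z.2 * ψ t z.1) :=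
          Measurable.iSup fun t => (Measurable.const_add
            ((measurable_snd.const_mul 2).mul ((hψ t).comp measurable_fst)) _).ennexp
        rw [lintegral_prod _ mψ.aemeasurable]
        refine lintegral_congr fun z => ?_
        rw [lintegral_rademacher]
        simp [sub_eq_add_neg]

/-! ### Tensorization over the sample -/

lemma lintegral_pi_succ {Z : Type*} [MeasurableSpace Z] (μ : Measure Z) [SigmaFinite μ] (n : ℕ)
    {F : (Fin (n + 1) → Z) → ℝ≥0∞} (hF : Measurable F) :
    ∫⁻ S, F S ∂(Measure.pi fun _ : Fin (n + 1) => μ) =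
      ∫⁻ z, ∫⁻ S, F (Fin.cons z S) ∂(Measure.pi fun _ : Fin n => μ) ∂μ := by
  have hp := (measurePreserving_piFinSuccAbove (fun _ : Fin (n + 1) => μ) 0).symm
  rw [← hp.lintegral_comp hF, lintegral_prod _ (by exact (hF.comp hp.measurable).aemeasurable)]
  refine lintegral_congr fun z => lintegral_congr fun S => congrArg F ?_
  exact Fin.insertNth_zero' z S

/-- Tensorization: a comparison of exponential moments of suprema, uniform over shifts, passes to
independent sums. -/
lemma lintegral_pi_iSup_ennexp_le {T Z Z' : Type*} [Countable T] [MeasurableSpace Z]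
    [MeasurableSpace Z'] (μ : Measure Z) [SigmaFinite μ] (ν : Measure Z') [SigmaFinite ν]
    (u : T → Z → ℝ) (v : T → Z' → ℝ) (hu : ∀ t, Measurable (u t)) (hv : ∀ t, Measurable (v t))
    (H : ∀ a : T → ℝ, ∫⁻ z, ⨆ t, ennexp (a t + u t z) ∂μ ≤ ∫⁻ z, ⨆ t, ennexp (a t + v t z) ∂ν)
    (n : ℕ) (a : T → ℝ) :
    ∫⁻ S, ⨆ t, ennexp (a t + ∑ i, u t (S i)) ∂(Measure.pi fun _ : Fin n => μ) ≤
      ∫⁻ S, ⨆ t, ennexp (a t + ∑ i, v t (S i)) ∂(Measure.pi fun _ : Fin n => ν) := by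
  induction n generalizing a with
  | zero => simp
  | succ n ih =>
    have mu : ∀ (k : ℕ) t, Measurable fun S : Fin k → Z => ∑ i, u t (S i) := fun k t =>
      Finset.measurable_fun_sum _ fun i _ => (hu t).comp (measurable_pi_apply i)
    have mv : ∀ (k : ℕ) t, Measurable fun S : Fin k → Z' => ∑ i, v t (S i) := fun k t =>
      Finset.measurable_fun_sum _ fun i _ => (hv t).comp (measurable_pi_apply i)
    rw [lintegral_pi_succ _ _ (Measurable.iSup fun t => ((mu _ t).const_add _).ennexp),
      lintegral_pi_succ _ _ (Measurable.iSup fun t => ((mv _ t).const_add _).ennexp)]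
    simp only [Fin.sum_univ_succ, Fin.cons_zero, Fin.cons_succ]
    -- The tail of the sample is exchanged with the head frozen inside the shift; after Fubini the
    -- head is exchanged with the tail frozen. Hence the need for `H` at every shift.
    calc _ ≤ ∫⁻ z, ∫⁻ S, ⨆ t, ennexp (a t + (u t z + ∑ i, v t (S i)))
              ∂(Measure.pi fun _ : Fin n => ν) ∂μ := by
          refine lintegral_mono fun z => ?_
          simpa only [add_assoc] using ih fun t => a t + u t z
      _ = ∫⁻ S, ∫⁻ z, ⨆ t, ennexp (a t + (u t z + ∑ i, v t (S i))) ∂μ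
              ∂(Measure.pi fun _ : Fin n => ν) := by
          refine lintegral_lintegral_swap (Measurable.aemeasurable ?_)
          exact Measurable.iSup fun t => ((((hu t).comp measurable_fst).add
            ((mv n t).comp measurable_snd)).const_add _).ennexp
      _ ≤ ∫⁻ S, ∫⁻ z, ⨆ t, ennexp (a t + (v t z + ∑ i, v t (S i))) ∂ν
              ∂(Measure.pi fun _ : Fin n => ν) := by
          refine lintegral_mono fun S => ?_
          have := H fun t => a t + ∑ i, v t (S i)
          simpa only [add_assoc, add_comm (∑ i, v _ (S i))] using this
      _ = _ := by
          refine lintegral_lintegral_swap (Measurable.aemeasurable ?_)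
          exact Measurable.iSup fun t => ((((hv t).comp measurable_snd).add
            ((mv n t).comp measurable_fst)).const_add _).ennexp

lemma lintegral_pi_ennexp_sum {Z : Type*} [MeasurableSpace Z] (μ : Measure Z) [SigmaFinite μ]
    {h : Z → ℝ} (hh : Measurable h) (n : ℕ) :
    ∫⁻ S, ennexp (∑ i, h (S i)) ∂(Measure.pi fun _ : Fin n => μ) =
      (∫⁻ z, ennexp (h z) ∂μ) ^ n := by
  induction n with
  | zero => simp [ennexp]
  | succ n ih =>
    have mh : ∀ k : ℕ, Measurable fun S : Fin k → Z => ∑ i, h (S i) := fun k =>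
      Finset.measurable_fun_sum _ fun i _ => hh.comp (measurable_pi_apply i)
    rw [lintegral_pi_succ _ _ (mh _).ennexp]
    simp only [Fin.sum_univ_succ, Fin.cons_zero, Fin.cons_succ, ennexp_add]
    simp_rw [lintegral_const_mul _ (mh n).ennexp, ih]
    rw [lintegral_mul_const _ hh.ennexp, pow_succ']

/-! ### Quadratic forms on a net of the sphere -/

section Net

variable {E : Type*} [NormedAddCommGroup E] [InnerProductSpace ℝ E]

/-- In a finite-dimensional space, the sphere of radius `2` has a `1`-net of at most `5 ^ dim`
points. -/
lemma exists_net_sphere (E : Type*) [NormedAddCommGroup E] [InnerProductSpace ℝ E]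
    [FiniteDimensional ℝ E] :
    ∃ N : Finset E, N.card ≤ 5 ^ Module.finrank ℝ E ∧ (∀ u ∈ N, ‖u‖ = 2) ∧
      ∀ v : E, ‖v‖ = 2 → ∃ u ∈ N, ‖v - u‖ ≤ 1 := by
  -- A separated set of maximal cardinality is a net. Radius `2` and separation `1` are the
  -- normalization of the packing bound `5 ^ dim`.
  classical
  let p : ℕ → Prop := fun m => ∃ N : Finset E, N.card = m ∧ (∀ u ∈ N, ‖u‖ = 2) ∧
    ∀ u ∈ N, ∀ v ∈ N, u ≠ v → 1 ≤ ‖u - v‖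
  have hb : ∀ m, p m → m ≤ 5 ^ Module.finrank ℝ E := by
    rintro m ⟨N, rfl, h1, h2⟩
    exact Besicovitch.card_le_of_separated N (fun u hu => (h1 u hu).le) h2
  have h0 : p 0 := ⟨∅, by simp⟩
  obtain ⟨N, hN, h1, h2⟩ : p (Nat.findGreatest p (5 ^ Module.finrank ℝ E)) :=
    Nat.findGreatest_spec (Nat.zero_le _) h0
  refine ⟨N, hN ▸ Nat.findGreatest_le _, h1, fun v hv => ?_⟩
  by_contra! hc
  have hvN : v ∉ N := fun h => by simpa using (hc v h).trans_le (by simp : ‖v - v‖ ≤ 1)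
  have hp : p (N.card + 1) := by
    refine ⟨insert v N, Finset.card_insert_of_notMem hvN, ?_, ?_⟩
    · intro u hu
      rcases Finset.mem_insert.1 hu with rfl | hu
      exacts [hv, h1 u hu]
    · intro u hu w hw huw
      rcases Finset.mem_insert.1 hu with hu' | hu' <;>
        rcases Finset.mem_insert.1 hw with hw' | hw'
      · exact absurd (hu'.trans hw'.symm) huw
      · rw [hu']; exact (hc w hw').le
      · rw [hw', norm_sub_rev]; exact (hc u hu').le
      · exact h2 u hu' w hw' huw
  have := Nat.le_findGreatest (hb _ hp) hp
  omega

/-- The quadratic form `∑ i, c i * ⟪x i, v⟫ ^ 2`. -/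
def quadForm {n : ℕ} (c : Fin n → ℝ) (x : Fin n → E) (v : E) : ℝ := ∑ i, c i * ⟪x i, v⟫ ^ 2

lemma quadForm_smul {n : ℕ} (c : Fin n → ℝ) (x : Fin n → E) (r : ℝ) (v : E) :
    quadForm c x (r • v) = r ^ 2 * quadForm c x v := by
  simp only [quadForm, inner_smul_right, Finset.mul_sum]
  exact Finset.sum_congr rfl fun i _ => by ring

/-- Polarization of `B(v - u, v + u)` with weights: the two arguments on the right are `±2(v - u) +
(v + u)/2`. For `u`, `v` on the sphere of radius `2` with `‖v - u‖ ≤ 1`, both summands then have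
norm at most `2`. -/
lemma quadForm_sub {n : ℕ} (c : Fin n → ℝ) (x : Fin n → E) (u v : E) :
    quadForm c x v - quadForm c x u = 1 / 4 * (quadForm c x ((5 / 2 : ℝ) • v - (3 / 2 : ℝ) • u) -
      quadForm c x ((3 / 2 : ℝ) • v - (5 / 2 : ℝ) • u)) := by
  simp only [quadForm, inner_smul_right, inner_sub_right, Finset.mul_sum, ← Finset.sum_sub_distrib]
  exact Finset.sum_congr rfl fun i _ => by ring

/-- The values of a quadratic form are controlled by its values on a net of the sphere. -/
lemma abs_quadForm_le_of_net [FiniteDimensional ℝ E] {n : ℕ} (c : Fin n → ℝ) (x : Fin n → E)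
    {N : Finset E} (hN : ∀ u ∈ N, ‖u‖ = 2) (hcov : ∀ v : E, ‖v‖ = 2 → ∃ u ∈ N, ‖v - u‖ ≤ 1)
    {m : ℝ} (hm : ∀ u ∈ N, |quadForm c x u| ≤ m) (v : E) :
    |quadForm c x v| ≤ 8 * m * ‖v‖ ^ 2 := by
  have hcont : Continuous fun v => |quadForm c x v| := by unfold quadForm; fun_prop
  have scale : ∀ q : ℝ, (∀ v : E, ‖v‖ = 2 → |quadForm c x v| ≤ 4 * q) →
      ∀ v, |quadForm c x v| ≤ q * ‖v‖ ^ 2 := by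
    intro q hq v
    by_cases hv : ‖v‖ = 0
    · rw [norm_eq_zero] at hv; subst hv; simp [quadForm]
    have h2 : ‖(2 / ‖v‖) • v‖ = 2 := by
      rw [norm_smul, Real.norm_eq_abs, abs_of_nonneg (by positivity)]; field_simp
    have h3 := hq _ h2
    rw [quadForm_smul, abs_mul, abs_of_nonneg (by positivity), div_pow, div_mul_eq_mul_div,
      div_le_iff₀ (by positivity)] at h3
    linarith
  by_cases hne : (Metric.sphere (0 : E) 2).Nonempty
  · obtain ⟨w, hw, hmax⟩ := (isCompact_sphere (0 : E) 2).exists_isMaxOn hne hcont.continuousOn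
    set q := |quadForm c x w| / 4 with hq
    have hqb : ∀ v, |quadForm c x v| ≤ q * ‖v‖ ^ 2 := scale q fun v hv => by
      have : |quadForm c x v| ≤ |quadForm c x w| :=
        hmax (show v ∈ Metric.sphere (0 : E) 2 by simpa using hv)
      linarith
    have hw2 : ‖w‖ = 2 := by simpa using hw
    obtain ⟨u, hu, huw⟩ := hcov w hw2
    have hu2 := hN u hu
    have hin : ‖w - u‖ ^ 2 = 8 - 2 * ⟪w, u⟫ := by
      rw [norm_sub_sq_real, hw2, hu2]; ring
    have hin' : ‖w - u‖ ^ 2 ≤ 1 := by nlinarith [norm_nonneg (w - u)]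
    have e1 : ‖(5 / 2 : ℝ) • w - (3 / 2 : ℝ) • u‖ ^ 2 = 34 - 15 / 2 * ⟪w, u⟫ := by
      rw [norm_sub_sq_real, norm_smul, norm_smul, inner_smul_left, inner_smul_right, hw2, hu2]
      norm_num; ring
    have e2 : ‖(3 / 2 : ℝ) • w - (5 / 2 : ℝ) • u‖ ^ 2 = 34 - 15 / 2 * ⟪w, u⟫ := by
      rw [norm_sub_sq_real, norm_smul, norm_smul, inner_smul_left, inner_smul_right, hw2, hu2]
      norm_num; ring
    have b1 := hqb ((5 / 2 : ℝ) • w - (3 / 2 : ℝ) • u)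
    have b2 := hqb ((3 / 2 : ℝ) • w - (5 / 2 : ℝ) • u)
    rw [e1] at b1
    rw [e2] at b2
    have hs := quadForm_sub c x u w
    have hmu := hm u hu
    have hq0 : 0 ≤ q := by positivity
    have h4 : 4 * q = |quadForm c x w| := by rw [hq]; ring
    -- Closeness gives `⟪w, u⟫ ≥ 7/2`, so both squared norms are at most `31/4`. Hence `4 * q ≤ m +
    -- (31/8) * q`, and `31/8 < 4` leaves `q ≤ 8 * m`.
    have hq1 : q * (34 - 15 / 2 * ⟪w, u⟫) ≤ q * (31 / 4) :=
      mul_le_mul_of_nonneg_left (by linarith) hq0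
    have h5 : |quadForm c x w| ≤ m + 1 / 2 * (q * (31 / 4)) := by
      rw [abs_le] at b1 b2 hmu ⊢
      constructor <;> linarith
    exact (hqb v).trans (mul_le_mul_of_nonneg_right (by linarith) (sq_nonneg _))
  · refine scale _ (fun v hv => absurd ⟨v, by simpa using hv⟩ hne) v

end Net

/-! ### Exponential moments of squared Gaussians -/

lemma lintegral_ennexp_mul_sq_gaussianReal {b : ℝ} (hb : b < 1 / 2) :
    ∫⁻ x, ennexp (b * x ^ 2) ∂(gaussianReal 0 1) = ENNReal.ofReal (1 / √(1 - 2 * b)) := by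
  have h2 : (0 : ℝ) < 1 / 2 - b := by linarith
  have hm : Measurable fun x : ℝ => ennexp (b * x ^ 2) :=
    ((measurable_id.pow_const 2).const_mul b).ennexp
  rw [gaussianReal_of_var_ne_zero 0 one_ne_zero,
    lintegral_withDensity_eq_lintegral_mul _ (measurable_gaussianPDF 0 1) hm]
  have e : ∀ x : ℝ, (gaussianPDF 0 1 * fun x => ennexp (b * x ^ 2)) x =
      ENNReal.ofReal ((√(2 * Real.pi))⁻¹ * Real.exp (-(1 / 2 - b) * x ^ 2)) := by
    intro x
    rw [Pi.mul_apply, gaussianPDF, ennexp, ← ENNReal.ofReal_mul (gaussianPDFReal_nonneg _ _ _),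
      gaussianPDFReal, mul_assoc, ← Real.exp_add]
    congr 3
    · simp
    · simp; ring
  simp only [e]
  rw [← ofReal_integral_eq_lintegral_ofReal ((integrable_exp_neg_mul_sq h2).const_mul _)
    (by filter_upwards with x; positivity), integral_const_mul, integral_gaussian]
  congr 1
  rw [← Real.sqrt_inv, ← Real.sqrt_mul (by positivity), one_div (√_), ← Real.sqrt_inv]
  congr 1
  have := Real.pi_pos
  have h3 : (1 : ℝ) - 2 * b ≠ 0 := by linarith
  field_simp

/-- Averaging over the sign of `b` cancels the linear term. With `p`, `r` the two roots, `p + r ≤ 2`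
bounds the average by `1 / (p * r)`, where `(p * r) ^ 2 = 1 - 4 * b ^ 2`. -/
lemma one_div_sqrt_add_le {b : ℝ} (hb : |b| ≤ 1 / 4) :
    1 / 2 * (1 / √(1 - 2 * b) + 1 / √(1 + 2 * b)) ≤ Real.exp (4 * b ^ 2) := by
  obtain ⟨h1, h2⟩ := abs_le.1 hb
  set p := √(1 - 2 * b) with hp
  set r := √(1 + 2 * b) with hr
  have hp0 : 0 < p := Real.sqrt_pos.2 (by linarith)
  have hr0 : 0 < r := Real.sqrt_pos.2 (by linarith)
  have hp2 : p ^ 2 = 1 - 2 * b := Real.sq_sqrt (by linarith)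
  have hr2 : r ^ 2 = 1 + 2 * b := Real.sq_sqrt (by linarith)
  have hpr : (p * r) ^ 2 = 1 - 4 * b ^ 2 := by rw [mul_pow, hp2, hr2]; ring
  have hpr0 := mul_pos hp0 hr0
  have hpr1 : p * r ≤ 1 := by nlinarith
  have hb2 : b ^ 2 ≤ 1 / 16 := by nlinarith
  have hpr2 : 1 - 4 * b ^ 2 ≤ p * r := by nlinarith
  have hs : p + r ≤ 2 := by nlinarith
  have h3 : 1 / 2 * (1 / p + 1 / r) ≤ 1 / (p * r) := by
    rw [div_add_div _ _ hp0.ne' hr0.ne', ← mul_div_assoc]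
    exact div_le_div_of_nonneg_right (by linarith) hpr0.le
  refine h3.trans ?_
  rw [div_le_iff₀ hpr0]
  nlinarith [Real.add_one_le_exp (4 * b ^ 2), sq_nonneg b]

/-! ### The network as a sum of quadratic forms in its rows -/

lemma frobNorm_nonneg {d k : ℕ} (W : Matrix (Fin k) (Fin d) ℝ) : 0 ≤ frobNorm W :=
  Real.sqrt_nonneg _

lemma sum_norm_sq_row {d k : ℕ} (W : Matrix (Fin k) (Fin d) ℝ) :
    ∑ j, ‖WithLp.toLp 2 (W j)‖ ^ 2 = frobNorm W ^ 2 := by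
  have h : 0 ≤ ∑ j, ∑ i, W j i ^ 2 :=
    Finset.sum_nonneg fun _ _ => Finset.sum_nonneg fun _ _ => sq_nonneg _
  rw [frobNorm, Real.sq_sqrt h]
  simp [EuclideanSpace.real_norm_sq_eq]

lemma network_eq_sum_inner {d k : ℕ} (x : EuclideanSpace ℝ (Fin d)) (W : Matrix (Fin k) (Fin d) ℝ) :
    network x W = ∑ j, ⟪x, WithLp.toLp 2 (W j)⟫ ^ 2 := by
  simp [network, PiLp.inner_apply]

lemma network_nonneg {d k : ℕ} (x : EuclideanSpace ℝ (Fin d)) (W : Matrix (Fin k) (Fin d) ℝ) :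
    0 ≤ network x W :=
  Finset.sum_nonneg fun _ _ => sq_nonneg _

lemma network_le {d k : ℕ} (x : EuclideanSpace ℝ (Fin d)) (W : Matrix (Fin k) (Fin d) ℝ) :
    network x W ≤ frobNorm W ^ 2 * ‖x‖ ^ 2 := by
  rw [network_eq_sum_inner, ← sum_norm_sq_row, Finset.sum_mul]
  refine Finset.sum_le_sum fun j _ => ?_
  rw [← mul_pow, mul_comm, ← sq_abs]
  exact pow_le_pow_left₀ (abs_nonneg _) (abs_real_inner_le_norm _ _) 2

lemma measurable_network {d k : ℕ} (W : Matrix (Fin k) (Fin d) ℝ) :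
    Measurable fun x : EuclideanSpace ℝ (Fin d) => network x W := by
  refine Continuous.measurable ?_
  unfold network
  fun_prop

lemma continuous_network_right {d k : ℕ} (x : EuclideanSpace ℝ (Fin d)) :
    Continuous fun W : Matrix (Fin k) (Fin d) ℝ => network x W := by
  unfold network
  refine continuous_finsetSum _ fun j _ => Continuous.pow (continuous_finsetSum _ fun i _ => ?_) 2
  exact (continuous_id.matrix_elem j i).mul continuous_const

lemma sum_mul_network {d k n : ℕ} (c : Fin n → ℝ) (x : Fin n → EuclideanSpace ℝ (Fin d))
    (W : Matrix (Fin k) (Fin d) ℝ) :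
    ∑ i, c i * network (x i) W = ∑ j, quadForm c x (WithLp.toLp 2 (W j)) := by
  simp only [network_eq_sum_inner, quadForm, Finset.mul_sum]
  exact Finset.sum_comm

/-! ### The signed Gaussian process -/

lemma map_inner_stdGaussian {E : Type*} [NormedAddCommGroup E] [InnerProductSpace ℝ E]
    [FiniteDimensional ℝ E] [MeasurableSpace E] [BorelSpace E] {u : E} (hu : ‖u‖ = 1) :
    (stdGaussian E).map (fun x => ⟪u, x⟫) = gaussianReal 0 1 := by
  have h := IsGaussian.map_eq_gaussianReal (μ := stdGaussian E) (innerSL ℝ u)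
  rw [integral_strongDual_stdGaussian, variance_dual_stdGaussian, innerSL_apply_norm, hu] at h
  simpa using h

lemma lintegral_ennexp_mul_inner_sq_stdGaussian {E : Type*} [NormedAddCommGroup E]
    [InnerProductSpace ℝ E] [FiniteDimensional ℝ E] [MeasurableSpace E] [BorelSpace E] {u : E}
    (hu : ‖u‖ = 2) {c : ℝ} (hc : 4 * c < 1 / 2) :
    ∫⁻ x, ennexp (c * ⟪x, u⟫ ^ 2) ∂(stdGaussian E) = ENNReal.ofReal (1 / √(1 - 2 * (4 * c))) := by
  have h1 : ‖(1 / 2 : ℝ) • u‖ = 1 := by rw [norm_smul, hu]; norm_num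
  have hm : Measurable fun x : ℝ => ennexp (4 * c * x ^ 2) :=
    ((measurable_id.pow_const 2).const_mul _).ennexp
  rw [← lintegral_ennexp_mul_sq_gaussianReal hc, ← map_inner_stdGaussian h1,
    lintegral_map hm (by fun_prop)]
  refine lintegral_congr fun x => ?_
  congr 1
  rw [real_inner_smul_left, real_inner_comm]
  ring

section RademacherProcess

variable {d : ℕ} {Y : Type*} [MeasurableSpace Y] {P : Measure (EuclideanSpace ℝ (Fin d) × Y)}

/-- The independent sign makes centring unnecessary. Since `‖u‖ = 2`, `⟪x, u⟫ ^ 2` is four times a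
squared standard normal, so `one_div_sqrt_add_le` applies with `b = 4 * c`. -/
lemma lintegral_signed_inner_sq [IsProbabilityMeasure P]
    (hP : P.map Prod.fst = stdGaussian (EuclideanSpace ℝ (Fin d)))
    {u : EuclideanSpace ℝ (Fin d)} (hu : ‖u‖ = 2) {c : ℝ} (hc : |c| ≤ 1 / 16) :
    ∫⁻ z, ennexp (c * (z.2 * ⟪z.1.1, u⟫ ^ 2)) ∂(P.prod rademacher) ≤ ennexp (64 * c ^ 2) := by
  obtain ⟨c1, c2⟩ := abs_le.1 hc
  have mi : ∀ c : ℝ, Measurable fun x : EuclideanSpace ℝ (Fin d) => ennexp (c * ⟪x, u⟫ ^ 2) :=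
    fun c => Measurable.ennexp (by fun_prop)
  have mj : Measurable fun z : (EuclideanSpace ℝ (Fin d) × Y) × ℝ =>
      ennexp (c * (z.2 * ⟪z.1.1, u⟫ ^ 2)) := Measurable.ennexp (by fun_prop)
  have hx : ∀ c : ℝ, 4 * c < 1 / 2 → ∫⁻ z, ennexp (c * ⟪z.1, u⟫ ^ 2) ∂P =
      ENNReal.ofReal (1 / √(1 - 2 * (4 * c))) := by
    intro c hc
    rw [← lintegral_ennexp_mul_inner_sq_stdGaussian hu hc, ← hP, lintegral_map (mi c) measurable_fst]
  rw [lintegral_prod_symm _ mj.aemeasurable, lintegral_rademacher]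
  have e1 := hx c (by linarith)
  have e2 := hx (-c) (by linarith)
  simp only [one_mul, neg_mul, mul_neg] at e1 e2 ⊢
  rw [e1, e2, ← ENNReal.ofReal_add (by positivity) (by positivity),
    show (2⁻¹ : ℝ≥0∞) = ENNReal.ofReal (1 / 2) by
      rw [one_div, ENNReal.ofReal_inv_of_pos two_pos, ENNReal.ofReal_ofNat],
    ← ENNReal.ofReal_mul (by norm_num)]
  refine ENNReal.ofReal_le_ofReal ?_
  have h4 : |4 * c| ≤ 1 / 4 := by rw [abs_mul]; norm_num; linarith
  have := one_div_sqrt_add_le h4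
  rwa [sub_neg_eq_add, show 64 * c ^ 2 = 4 * (4 * c) ^ 2 by ring]

/-- Exponential moment of the supremum of the Rademacher process indexed by a Frobenius ball. -/
lemma lintegral_iSup_rademacher_process_le [IsProbabilityMeasure P] (hd : 1 ≤ d)
    (hP : P.map Prod.fst = stdGaussian (EuclideanSpace ℝ (Fin d)))
    {k n : ℕ} {T : Type*} (W : T → Matrix (Fin k) (Fin d) ℝ) {M : ℝ} (hM : 0 < M)
    (hW : ∀ t, frobNorm (W t) ≤ M) {s : ℝ} (hs : 0 ≤ s) (hs' : 16 * s ≤ 1 / 16) :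
    ∫⁻ S, ⨆ t, ennexp (∑ i, 2 * (S i).2 * (s / M ^ 2 * network (S i).1.1 (W t)))
        ∂(Measure.pi fun _ : Fin n => P.prod rademacher) ≤
      5 ^ d * (2 * ennexp (64 * (16 * s) ^ 2) ^ n) := by
  obtain ⟨N, hNc, hN, hcov⟩ := exists_net_sphere (EuclideanSpace ℝ (Fin d))
  rw [finrank_euclideanSpace_fin] at hNc
  have hne : N.Nonempty := by
    obtain ⟨u, hu, -⟩ := hcov (EuclideanSpace.single ⟨0, hd⟩ 2) (by simp)
    exact ⟨u, hu⟩
  set Q : (Fin n → (EuclideanSpace ℝ (Fin d) × Y) × ℝ) → EuclideanSpace ℝ (Fin d) → ℝ :=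
    fun S u => ∑ i, (S i).2 * ⟪(S i).1.1, u⟫ ^ 2 with hQ
  have mQ : ∀ (c : ℝ) u, Measurable fun S => ennexp (c * Q S u) := fun c u =>
    Measurable.ennexp (by fun_prop)
  have point : ∀ S, (⨆ t, ennexp (∑ i, 2 * (S i).2 * (s / M ^ 2 * network (S i).1.1 (W t)))) ≤
      ∑ u ∈ N, (ennexp (16 * s * Q S u) + ennexp (-(16 * s) * Q S u)) := by
    intro S
    refine iSup_le fun t => ?_
    obtain ⟨w, hw, hmax⟩ := N.exists_max_image (fun u => |Q S u|) hne
    have hb := abs_quadForm_le_of_net (fun i => (S i).2) (fun i => (S i).1.1) hN hcov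
      (m := |Q S w|) hmax
    have h1 : ∑ i, (S i).2 * network (S i).1.1 (W t) ≤ 8 * |Q S w| * M ^ 2 := by
      rw [sum_mul_network (fun i => (S i).2) (fun i => (S i).1.1)]
      calc _ ≤ ∑ j, 8 * |Q S w| * ‖WithLp.toLp 2 (W t j)‖ ^ 2 :=
            Finset.sum_le_sum fun j _ => (le_abs_self _).trans (hb _)
        _ = 8 * |Q S w| * frobNorm (W t) ^ 2 := by rw [← Finset.mul_sum, sum_norm_sq_row]
        _ ≤ _ := by
            have := pow_le_pow_left₀ (frobNorm_nonneg _) (hW t) 2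
            gcongr
    -- The factor `16` is the `2` from symmetrization times the `8` from the net.
    have h2 : ∑ i, 2 * (S i).2 * (s / M ^ 2 * network (S i).1.1 (W t)) ≤ 16 * s * |Q S w| := by
      calc _ = 2 * s / M ^ 2 * ∑ i, (S i).2 * network (S i).1.1 (W t) := by
            rw [Finset.mul_sum]; exact Finset.sum_congr rfl fun i _ => by ring
        _ ≤ 2 * s / M ^ 2 * (8 * |Q S w| * M ^ 2) := by gcongr
        _ = _ := by field_simp; ring
    refine (ennexp_mono h2).trans ?_
    refine le_trans ?_ (Finset.single_le_sum (fun _ _ => zero_le) hw)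
    rcases abs_choice (Q S w) with e | e <;> rw [e]
    · exact le_self_add
    · rw [mul_neg, ← neg_mul]; exact le_add_self
  have moment : ∀ u ∈ N, ∀ c : ℝ, |c| = 16 * s →
      ∫⁻ S, ennexp (c * Q S u) ∂(Measure.pi fun _ : Fin n => P.prod rademacher) ≤
        ennexp (64 * (16 * s) ^ 2) ^ n := by
    intro u hu c hc
    simp only [hQ, Finset.mul_sum]
    rw [lintegral_pi_ennexp_sum (P.prod rademacher) (h := fun z => c * (z.2 * ⟪z.1.1, u⟫ ^ 2))
      (by fun_prop), ← hc, sq_abs]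
    exact pow_le_pow_left₀ zero_le (lintegral_signed_inner_sq hP (hN u hu) (hc.trans_le hs')) n
  calc _ ≤ ∫⁻ S, ∑ u ∈ N, (ennexp (16 * s * Q S u) + ennexp (-(16 * s) * Q S u))
          ∂(Measure.pi fun _ : Fin n => P.prod rademacher) := lintegral_mono point
    _ = ∑ u ∈ N, (∫⁻ S, ennexp (16 * s * Q S u) ∂(Measure.pi fun _ : Fin n => P.prod rademacher) +
          ∫⁻ S, ennexp (-(16 * s) * Q S u) ∂(Measure.pi fun _ : Fin n => P.prod rademacher)) := by
        rw [lintegral_finsetSum _ fun u _ => by exact (mQ _ u).add (mQ _ u)]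
        exact Finset.sum_congr rfl fun u _ => lintegral_add_left (mQ _ u) _
    _ ≤ ∑ u ∈ N, 2 * ennexp (64 * (16 * s) ^ 2) ^ n := by
        refine Finset.sum_le_sum fun u hu => ?_
        rw [two_mul]
        exact add_le_add (moment u hu _ (abs_of_nonneg (by positivity)))
          (moment u hu _ (by rw [abs_neg]; exact abs_of_nonneg (by positivity)))
    _ ≤ _ := by
        rw [Finset.sum_const, nsmul_eq_mul]
        gcongr
        exact_mod_cast hNc

end RademacherProcess

/-- Net size times moment bound against the Markov level `exp (4 * d)`, with a factor `1 / d` to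
spare: `5 ≤ exp 2`, `d ≤ exp d` and `2 + 1/4 + 1 ≤ 4`. -/
lemma five_pow_mul_exp_le {d : ℕ} :
    (5 : ℝ) ^ d * (2 * Real.exp (d / 4)) * d ≤ 2 * Real.exp (4 * d) := by
  have h1 : (5 : ℝ) ^ d ≤ Real.exp (2 * d) := by
    have : (5 : ℝ) ≤ Real.exp 2 := by
      have h := Real.exp_one_gt_d9
      have e : Real.exp 2 = Real.exp 1 * Real.exp 1 := by rw [← Real.exp_add]; norm_num
      rw [e]; nlinarith
    calc (5 : ℝ) ^ d ≤ Real.exp 2 ^ d := pow_le_pow_left₀ (by norm_num) this d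
      _ = _ := by rw [← Real.exp_nat_mul, mul_comm]
  have h2 : (d : ℝ) ≤ Real.exp d := by linarith [Real.add_one_le_exp (d : ℝ)]
  calc (5 : ℝ) ^ d * (2 * Real.exp (d / 4)) * d
      ≤ Real.exp (2 * d) * (2 * Real.exp (d / 4)) * Real.exp d := by gcongr
    _ = 2 * Real.exp (2 * d + d / 4 + d) := by rw [Real.exp_add, Real.exp_add]; ring
    _ ≤ 2 * Real.exp (4 * d) := by
        gcongr
        have : (0 : ℝ) ≤ d := d.cast_nonneg
        linarith

/-! ### Deviation of the loss at zero -/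

/-- Chebyshev's inequality for a sample mean. -/
lemma measure_pi_mean_deviation_le {Z : Type*} [MeasurableSpace Z] (P : Measure Z)
    [IsProbabilityMeasure P] {h : Z → ℝ} (hm : Measurable h) {d n : ℕ} (hd : 1 ≤ d)
    (hn : 1 ≤ n) {c : ℝ} (hc : 0 < c) :
    Measure.pi (fun _ : Fin n => P)
        {S | c * √(d / n) < ∫ z, h z ∂P - (1 / (n : ℝ)) * ∑ i, h (S i)} ≤
      evariance h P / ENNReal.ofReal (c ^ 2) / d := by
  have hd0 : (0 : ℝ) < d := by exact_mod_cast hd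
  have hn0 : (0 : ℝ) < n := by exact_mod_cast hn
  -- Without a second moment the variance is `∞` and the bound is trivial.
  by_cases hL : MemLp h 2 P
  swap
  · rw [evariance_eq_top hm.aestronglyMeasurable hL, ENNReal.top_div_of_ne_top ENNReal.ofReal_ne_top,
      ENNReal.top_div_of_ne_top (ENNReal.natCast_ne_top d)]
    exact le_top
  set X : (Fin n → Z) → ℝ := ∑ i, fun S => h (S i) with hX
  have hXe : ∀ S, X S = ∑ i, h (S i) := fun S => by simp [hX]
  have hLi : ∀ i : Fin n, MemLp (fun S : Fin n → Z => h (S i)) 2 (Measure.pi fun _ => P) :=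
    fun i => hL.comp_measurePreserving (measurePreserving_eval (fun _ : Fin n => P) i)
  have hXL : MemLp X 2 (Measure.pi fun _ : Fin n => P) := memLp_finsetSum' _ fun i _ => hLi i
  have hV : variance X (Measure.pi fun _ : Fin n => P) = n * variance h P := by
    rw [hX, variance_sum_pi (X := fun _ => h) fun _ => hL]
    simp
  have hE : ∫ S, X S ∂(Measure.pi fun _ : Fin n => P) = n * ∫ z, h z ∂P := by
    simp only [hXe]
    rw [integral_finsetSum _ fun i _ => (hLi i).integrable one_le_two]
    have : ∀ i : Fin n, ∫ S, h (S i) ∂(Measure.pi fun _ : Fin n => P) = ∫ z, h z ∂P := fun i => by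
      have hp := measurePreserving_eval (fun _ : Fin n => P) i
      conv_rhs => rw [← hp.map_eq]
      rw [integral_map hp.measurable.aemeasurable hm.aestronglyMeasurable]
    simp [this]
  have hr0 : 0 < √((d : ℝ) / n) := Real.sqrt_pos.2 (by positivity)
  have hr2 : √((d : ℝ) / n) ^ 2 = d / n := Real.sq_sqrt (by positivity)
  have ht : 0 < n * (c * √((d : ℝ) / n)) := by positivity
  have cheb := meas_ge_le_variance_div_sq hXL ht
  rw [hV, hE] at cheb
  refine (measure_mono fun S hS => ?_).trans (cheb.trans_eq ?_)
  · simp only [Set.mem_ofPred_eq] at hS ⊢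
    rw [hXe, abs_sub_comm]
    refine le_trans ?_ (le_abs_self _)
    have := mul_le_mul_of_nonneg_left hS.le hn0.le
    rw [mul_sub, ← mul_assoc _ (1 / (n : ℝ)), mul_one_div_cancel hn0.ne', one_mul] at this
    exact this
  · rw [← hL.ofReal_variance_eq, ← ENNReal.ofReal_natCast d,
      ← ENNReal.ofReal_div_of_pos (by positivity), ← ENNReal.ofReal_div_of_pos hd0, mul_pow, mul_pow,
      hr2]
    congr 1
    field_simp

/-! ### The excess loss and its uniform deviation -/

section ExcessLoss

variable {d k : ℕ} {Y : Type*} {L : ℝ≥0} {ℓ : ℝ → Y → ℝ} {M : ℝ}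

/-- The loss of the network in excess of the loss of the zero network. -/
def excessLoss (ℓ : ℝ → Y → ℝ) (W : Matrix (Fin k) (Fin d) ℝ)
    (z : EuclideanSpace ℝ (Fin d) × Y) : ℝ :=
  ℓ (network z.1 W) z.2 - ℓ 0 z.2

lemma abs_excessLoss_sub_le (hL : ∀ y, LipschitzWith L (fun u => ℓ u y))
    (W V : Matrix (Fin k) (Fin d) ℝ) (z : EuclideanSpace ℝ (Fin d) × Y) :
    |excessLoss ℓ W z - excessLoss ℓ V z| ≤ L * |network z.1 W - network z.1 V| := by
  have := (hL z.2).dist_le_mul (network z.1 W) (network z.1 V)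
  simpa [excessLoss, Real.dist_eq] using this

lemma abs_excessLoss_le (hL : ∀ y, LipschitzWith L (fun u => ℓ u y))
    (W : Matrix (Fin k) (Fin d) ℝ) (z : EuclideanSpace ℝ (Fin d) × Y) :
    |excessLoss ℓ W z| ≤ L * network z.1 W := by
  have := (hL z.2).dist_le_mul (network z.1 W) 0
  simpa [excessLoss, Real.dist_eq, abs_of_nonneg (network_nonneg z.1 W)] using this

lemma abs_excessLoss_le_of_mem (hL : ∀ y, LipschitzWith L (fun u => ℓ u y))
    {W : Matrix (Fin k) (Fin d) ℝ} (hW : W ∈ frobBall k d M) (z : EuclideanSpace ℝ (Fin d) × Y) :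
    |excessLoss ℓ W z| ≤ L * M ^ 2 * ‖z.1‖ ^ 2 := by
  refine (abs_excessLoss_le hL W z).trans ?_
  rw [mul_assoc]
  have := pow_le_pow_left₀ (frobNorm_nonneg W) hW 2
  have := network_le z.1 W
  gcongr
  exact this.trans (by gcongr)

end ExcessLoss

section Deviation

variable {d k : ℕ} {Y : Type*} [MeasurableSpace Y] {P : Measure (EuclideanSpace ℝ (Fin d) × Y)}
  {L : ℝ≥0} {ℓ : ℝ → Y → ℝ} {M : ℝ}

lemma measurable_loss (hm : ∀ u, Measurable (ℓ u))
    (hL : ∀ y, LipschitzWith L (fun u => ℓ u y)) : Measurable (Function.uncurry ℓ) :=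
  measurable_uncurry_of_continuous_of_measurable (fun y => (hL y).continuous) hm

lemma measurable_excessLoss (hm : ∀ u, Measurable (ℓ u))
    (hL : ∀ y, LipschitzWith L (fun u => ℓ u y)) (W : Matrix (Fin k) (Fin d) ℝ) :
    Measurable (excessLoss ℓ W) :=
  ((measurable_loss hm hL).comp
    (((measurable_network W).comp measurable_fst).prodMk measurable_snd)).sub
    ((hm 0).comp measurable_snd)

lemma integrable_norm_sq_fst (hP : P.map Prod.fst = stdGaussian (EuclideanSpace ℝ (Fin d))) :
    Integrable (fun z => ‖z.1‖ ^ 2) P := by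
  have h : Integrable (fun x : EuclideanSpace ℝ (Fin d) => ‖x‖ ^ 2) (P.map Prod.fst) := by
    rw [hP]
    exact (IsGaussian.memLp_two_id (μ := stdGaussian (EuclideanSpace ℝ (Fin d)))).integrable_norm_pow
      two_ne_zero
  exact h.comp_measurable measurable_fst

lemma integrable_excessLoss (hm : ∀ u, Measurable (ℓ u))
    (hL : ∀ y, LipschitzWith L (fun u => ℓ u y))
    (hP : P.map Prod.fst = stdGaussian (EuclideanSpace ℝ (Fin d)))
    {W : Matrix (Fin k) (Fin d) ℝ} (hW : W ∈ frobBall k d M) :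
    Integrable (excessLoss ℓ W) P :=
  ((integrable_norm_sq_fst hP).const_mul (L * M ^ 2)).mono'
    (measurable_excessLoss hm hL W).aestronglyMeasurable
    (Filter.Eventually.of_forall fun z => abs_excessLoss_le_of_mem hL hW z)

lemma testLoss_sub_trainLoss_eq (hm : ∀ u, Measurable (ℓ u))
    (hL : ∀ y, LipschitzWith L (fun u => ℓ u y)) (h0 : Integrable (fun z => ℓ 0 z.2) P)
    (hP : P.map Prod.fst = stdGaussian (EuclideanSpace ℝ (Fin d))) {n : ℕ}
    (S : Fin n → EuclideanSpace ℝ (Fin d) × Y)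
    {W : Matrix (Fin k) (Fin d) ℝ} (hW : W ∈ frobBall k d M) :
    testLoss ℓ P W - trainLoss ℓ S W =
      (∫ z, excessLoss ℓ W z ∂P - (1 / (n : ℝ)) * ∑ i, excessLoss ℓ W (S i)) +
        (∫ z, ℓ 0 z.2 ∂P - (1 / (n : ℝ)) * ∑ i, ℓ 0 (S i).2) := by
  have h : testLoss ℓ P W = ∫ z, excessLoss ℓ W z ∂P + ∫ z, ℓ 0 z.2 ∂P := by
    rw [← integral_add (integrable_excessLoss hm hL hP hW) h0]
    simp [testLoss, excessLoss]
  rw [h, trainLoss]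
  simp only [excessLoss, Finset.sum_sub_distrib]
  ring

/-- Dominated convergence with the envelope `L * M ^ 2 * ‖x‖ ^ 2`. Continuity makes violation of the
bound an open condition on `W`, so it can be tested on a countable dense set. -/
lemma continuous_testLoss_sub_trainLoss (hm : ∀ u, Measurable (ℓ u))
    (hL : ∀ y, LipschitzWith L (fun u => ℓ u y)) (h0 : Integrable (fun z => ℓ 0 z.2) P)
    (hP : P.map Prod.fst = stdGaussian (EuclideanSpace ℝ (Fin d))) {n : ℕ}
    (S : Fin n → EuclideanSpace ℝ (Fin d) × Y) :
    Continuous fun W : frobBall k d M => testLoss ℓ P W.1 - trainLoss ℓ S W.1 := by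
  have : SecondCountableTopology (Matrix (Fin k) (Fin d) ℝ) :=
    inferInstanceAs (SecondCountableTopology (Fin k → Fin d → ℝ))
  have hc : ∀ z : EuclideanSpace ℝ (Fin d) × Y,
      Continuous fun W : frobBall k d M => excessLoss ℓ W.1 z := fun z =>
    ((hL z.2).continuous.comp ((continuous_network_right z.1).comp continuous_subtype_val)).sub
      continuous_const
  simp only [fun W : frobBall k d M => testLoss_sub_trainLoss_eq hm hL h0 hP S W.2]
  refine Continuous.add (Continuous.sub ?_ (continuous_const.mul
    (continuous_finsetSum _ fun i _ => hc (S i)))) continuous_const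
  exact continuous_of_dominated
    (fun W => (measurable_excessLoss hm hL W.1).aestronglyMeasurable)
    (fun W => Filter.Eventually.of_forall fun z => abs_excessLoss_le_of_mem hL W.2 z)
    ((integrable_norm_sq_fst hP).const_mul (L * M ^ 2)) (Filter.Eventually.of_forall hc)

/-- Uniform deviation bound for the excess loss over a countable family of weights. -/
lemma measure_pi_excessLoss_deviation_le [IsProbabilityMeasure P] {n : ℕ} (hd : 1 ≤ d)
    (hdn : d ≤ n) (hm : ∀ u, Measurable (ℓ u)) (hL : ∀ y, LipschitzWith L (fun u => ℓ u y))
    (hP : P.map Prod.fst = stdGaussian (EuclideanSpace ℝ (Fin d)))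
    (hM : 0 < M) (hL0 : 0 < (L : ℝ)) {T : Type*} [Countable T] (W : T → frobBall k d M) :
    Measure.pi (fun _ : Fin n => P)
        {S | ∃ t, 1024 * (L * M ^ 2) * √(d / n) <
          ∫ z, excessLoss ℓ (W t).1 z ∂P - (1 / (n : ℝ)) * ∑ i, excessLoss ℓ (W t).1 (S i)} ≤
      2 / d := by
  have hd0 : (0 : ℝ) < d := by exact_mod_cast hd
  have hn0 : (0 : ℝ) < n := hd0.trans_le (by exact_mod_cast hdn)
  set r := √((d : ℝ) / n) with hr
  have hr0 : 0 < r := Real.sqrt_pos.2 (by positivity)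
  have hr2 : r ^ 2 = d / n := Real.sq_sqrt (by positivity)
  have hr1 : r ≤ 1 := Real.sqrt_le_one.2 ((div_le_one hn0).2 (by exact_mod_cast hdn))
  -- This choice gives `16 * s = r / 16 ≤ 1 / 16`, as the moment bound requires, and `64 * (16 * s)
  -- ^ 2 * n = d / 4`. The scale `κ` turns the Lipschitz constant `L` into `s / M ^ 2`.
  set s := r / 256 with hs
  set κ := s / (L * M ^ 2) with hκ
  have hs0 : 0 < s := by positivity
  have hκ0 : 0 < κ := by positivity
  set g : T → EuclideanSpace ℝ (Fin d) × Y → ℝ := fun t z => κ * excessLoss ℓ (W t).1 z with hg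
  have hgm : ∀ t, Measurable (g t) := fun t => (measurable_excessLoss hm hL (W t).1).const_mul κ
  have hκL : κ * L = s / M ^ 2 := by rw [hκ]; field_simp
  have step := lintegral_pi_iSup_ennexp_le P (P.prod rademacher)
    (fun t z => ∫ z', g t z' ∂P - g t z)
    (fun t z => 2 * z.2 * (s / M ^ 2 * network z.1.1 (W t).1))
    (fun t => (hgm t).const_sub _)
    (fun t => (measurable_snd.const_mul 2).mul
      (((measurable_network (W t).1).comp (measurable_fst.comp measurable_fst)).const_mul _))
    (fun a => lintegral_iSup_ennexp_symmetrization P a g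
      (fun t z => s / M ^ 2 * network z.1 (W t).1) hgm
      (fun t => ((measurable_network (W t).1).comp measurable_fst).const_mul _)
      (fun t => (integrable_excessLoss hm hL hP (W t).2).const_mul κ)
      (fun t z => by
        rw [← hκL, hg, abs_mul, abs_of_pos hκ0, mul_assoc]
        exact mul_le_mul_of_nonneg_left (abs_excessLoss_le hL _ z) hκ0.le)
      (fun t t' z => by
        simp only [hg]
        rw [← hκL, ← mul_sub, ← mul_sub, abs_mul, abs_mul, abs_mul, abs_of_pos hκ0,
          abs_of_pos hL0, mul_assoc]
        exact mul_le_mul_of_nonneg_left (abs_excessLoss_sub_le hL _ _ z) hκ0.le))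
    n (fun _ => 0)
  simp only [zero_add] at step
  have proc := lintegral_iSup_rademacher_process_le (n := n) hd hP (fun t => (W t).1) hM
    (fun t => (W t).2) hs0.le (by rw [hs]; linarith)
  have hpow : ennexp (64 * (16 * s) ^ 2) ^ n = ennexp (d / 4) := by
    rw [ennexp, ennexp, ← ENNReal.ofReal_pow (Real.exp_pos _).le, ← Real.exp_nat_mul]
    congr 2
    have : (16 * s) ^ 2 = r ^ 2 / 256 := by rw [hs]; ring
    rw [this, hr2]
    field_simp
    norm_num
  rw [hpow] at proc
  have markov := mul_meas_ge_le_lintegral (μ := Measure.pi fun _ : Fin n => P)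
    (f := fun S => ⨆ t, ennexp (∑ i, (∫ z', g t z' ∂P - g t (S i))))
    (Measurable.iSup fun t => (Finset.measurable_fun_sum _ fun i _ =>
      ((hgm t).comp (measurable_pi_apply i)).const_sub _).ennexp) (ennexp (4 * d))
  have hsub : {S : Fin n → EuclideanSpace ℝ (Fin d) × Y | ∃ t, 1024 * (L * M ^ 2) * r <
        ∫ z, excessLoss ℓ (W t).1 z ∂P - (1 / (n : ℝ)) * ∑ i, excessLoss ℓ (W t).1 (S i)} ⊆
      {S | ennexp (4 * d) ≤ ⨆ t, ennexp (∑ i, (∫ z', g t z' ∂P - g t (S i)))} := by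
    rintro S ⟨t, ht⟩
    refine le_trans (ennexp_mono ?_)
      (le_iSup (fun t => ennexp (∑ i, (∫ z', g t z' ∂P - g t (S i)))) t)
    simp only [hg, Finset.sum_sub_distrib, integral_const_mul, ← Finset.mul_sum]
    rw [Finset.sum_const, Finset.card_univ, Fintype.card_fin, nsmul_eq_mul]
    have h1 := mul_le_mul_of_nonneg_left ht.le (mul_pos hκ0 hn0).le
    -- The constant `1024 = 4 * 256` makes the rescaled threshold exactly `4 * d`.
    have e1 : κ * n * (1024 * (L * M ^ 2) * r) = 4 * d := by
      have : κ * n * (1024 * (L * M ^ 2) * r) = 4 * n * r ^ 2 := by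
        rw [hκ, hs]; field_simp; norm_num
      rw [this, hr2]; field_simp
    rw [e1] at h1
    refine h1.trans_eq ?_
    field_simp
  have hb : ennexp (4 * d) * Measure.pi (fun _ : Fin n => P)
      {S | ∃ t, 1024 * (L * M ^ 2) * r <
        ∫ z, excessLoss ℓ (W t).1 z ∂P - (1 / (n : ℝ)) * ∑ i, excessLoss ℓ (W t).1 (S i)} ≤
      5 ^ d * (2 * ennexp (d / 4)) :=
    (mul_le_mul_right (measure_mono hsub) _).trans (markov.trans (step.trans proc))
  have hnum : (5 : ℝ≥0∞) ^ d * (2 * ennexp (d / 4)) * d ≤ 2 * ennexp (4 * d) := by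
    have := ENNReal.ofReal_le_ofReal (five_pow_mul_exp_le (d := d))
    rw [ENNReal.ofReal_mul (by positivity), ENNReal.ofReal_mul (by positivity),
      ENNReal.ofReal_mul (by positivity), ENNReal.ofReal_mul (by positivity),
      ENNReal.ofReal_pow (by positivity)] at this
    simpa [ennexp] using this
  rw [ENNReal.le_div_iff_mul_le (Or.inl (by exact_mod_cast hd0.ne'))
    (Or.inl (ENNReal.natCast_ne_top d))]
  refine (ENNReal.mul_le_mul_iff_right (ennexp_ne_zero (4 * d)) (ennexp_ne_top _)).1 ?_
  rw [← mul_assoc, mul_comm _ (2 : ℝ≥0∞)]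
  exact (mul_le_mul_left hb _).trans hnum

end Deviation

/-! ### Degenerate cases and conclusion -/

/-- The sample size condition enters only through `d ≤ n`. For `d ≥ 3` one has `log d ≥ 1`; for `d =
2`, `2 * log 2 > 1` excludes `n = 1`. -/
lemma le_of_mul_log_le {d n : ℕ} (hd : 1 ≤ d) (hn : 1 ≤ n) (h : (d : ℝ) * Real.log d ≤ n) :
    d ≤ n := by
  rcases Nat.lt_or_ge d 3 with h3 | h3
  · interval_cases d
    · exact hn
    · by_contra! hc
      have : n = 1 := by omega
      subst this
      have := Real.log_two_gt_d9
      push_cast at h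
      linarith
  · have h1 : 1 ≤ Real.log d := by
      rw [Real.le_log_iff_exp_le (by positivity)]
      have : (3 : ℝ) ≤ d := by exact_mod_cast h3
      linarith [Real.exp_one_lt_d9]
    have : (d : ℝ) ≤ n := le_trans (le_mul_of_one_le_right d.cast_nonneg h1) h
    exact_mod_cast this

/-- If the loss does not vary over the Frobenius ball and its variance vanishes, the generalization
gap is almost surely zero. -/
lemma measure_pi_gap_eq_zero {d k n : ℕ} {Y : Type*} [MeasurableSpace Y]
    {P : Measure (EuclideanSpace ℝ (Fin d) × Y)} [IsProbabilityMeasure P]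
    {L : ℝ≥0} {ℓ : ℝ → Y → ℝ} {M : ℝ} (hn : 1 ≤ n) (hm : ∀ u, Measurable (ℓ u))
    (hL : ∀ y, LipschitzWith L (fun u => ℓ u y)) (h0 : Integrable (fun z => ℓ 0 z.2) P)
    (hP : P.map Prod.fst = stdGaussian (EuclideanSpace ℝ (Fin d)))
    (hLM : (L : ℝ) * M ^ 2 = 0) (hv : evariance (fun z => ℓ 0 z.2) P = 0) :
    Measure.pi (fun _ : Fin n => P)
      {S | ∃ W ∈ frobBall k d M, 0 < testLoss ℓ P W - trainLoss ℓ S W} = 0 := by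
  have hn0 : (n : ℝ) ≠ 0 := by positivity
  rw [evariance_eq_zero_iff h0.aemeasurable] at hv
  have hall : ∀ᵐ S ∂(Measure.pi fun _ : Fin n => P), ∀ i, ℓ 0 (S i).2 = ∫ z, ℓ 0 z.2 ∂P :=
    ae_all_iff.2 fun i =>
      (measurePreserving_eval (fun _ : Fin n => P) i).quasiMeasurePreserving.ae hv
  refine measure_mono_null ?_ (ae_iff.1 hall)
  rintro S ⟨W, hW, hlt⟩ hS
  have hz : ∀ z, excessLoss ℓ W z = 0 := fun z => by
    have := abs_excessLoss_le_of_mem hL hW z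
    rw [hLM, zero_mul] at this
    exact abs_nonpos_iff.1 this
  rw [testLoss_sub_trainLoss_eq hm hL h0 hP S hW] at hlt
  simp [hz, hS, hn0] at hlt

end QuadNet

open QuadNet in
theorem theorem7 :
    ∃ C : ℝ, 0 < C ∧
      ∀ (Y : Type*) [MeasurableSpace Y] (d k n : ℕ) (M : ℝ) (L : ℝ≥0) (ℓ : ℝ → Y → ℝ)
        (P : Measure (EuclideanSpace ℝ (Fin d) × Y)) [IsProbabilityMeasure P],
        1 ≤ d → 1 ≤ n → (d : ℝ) * Real.log d ≤ n → 0 ≤ M →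
        (∀ u, Measurable (ℓ u)) →
        (∀ y, LipschitzWith L (fun u => ℓ u y)) →
        Integrable (fun z => ℓ 0 z.2) P →
        -- the inputs are standard Gaussian
        P.map Prod.fst = stdGaussian (EuclideanSpace ℝ (Fin d)) →
        -- outer probability, under an i.i.d. sample `S`, that the bound fails for some `W`
        Measure.pi (fun _ : Fin n => P)
            {S | ∃ W ∈ QuadNet.frobBall k d M,
              C * L * M ^ 2 * Real.sqrt (d / n) <
                QuadNet.testLoss ℓ P W - QuadNet.trainLoss ℓ S W} ≤
          ENNReal.ofReal C / d *
            (1 + evariance (fun z => ℓ 0 z.2) P / ENNReal.ofReal (L ^ 2 * M ^ 4)) := by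
  -- `1024` for the excess loss plus `1` for the loss at zero.
  refine ⟨1025, by norm_num, ?_⟩
  intro Y _ d k n M L ℓ P _ hd hn hdn hM hm hL h0 hP
  have hLM4 : (L : ℝ) ^ 2 * M ^ 4 = (L * M ^ 2) ^ 2 := by ring
  rw [hLM4]
  rcases (by positivity : 0 ≤ (L : ℝ) * M ^ 2).eq_or_lt with hLM | hLM
  -- In `ℝ≥0∞`, `0 / 0 = 0` and `v / 0 = ∞` for `v ≠ 0`, which is the stated convention for the
  -- quotient when `L * M = 0`.
  · by_cases hv : evariance (fun z => ℓ 0 z.2) P = 0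
    · have hz := measure_pi_gap_eq_zero (k := k) hn hm hL h0 hP hLM.symm hv
      simp only [mul_assoc (1025 : ℝ), ← hLM, mul_zero, zero_mul]
      exact hz.trans_le zero_le
    · rw [← hLM, zero_pow two_ne_zero, ENNReal.ofReal_zero, ENNReal.div_zero hv, add_top,
        ENNReal.mul_top]
      · exact le_top
      · exact (ENNReal.div_pos (by simp) (ENNReal.natCast_ne_top d)).ne'
  have hL0 : 0 < (L : ℝ) := L.coe_nonneg.lt_of_ne' (left_ne_zero_of_mul hLM.ne')
  have hM0 : 0 < M := hM.lt_of_ne' fun h => by simp [h] at hLM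
  have : SecondCountableTopology (Matrix (Fin k) (Fin d) ℝ) :=
    inferInstanceAs (SecondCountableTopology (Fin k → Fin d → ℝ))
  obtain ⟨D, hDc, hD⟩ := TopologicalSpace.exists_countable_dense (frobBall k d M)
  have := hDc.to_subtype
  have hsub : {S : Fin n → EuclideanSpace ℝ (Fin d) × Y | ∃ W ∈ frobBall k d M,
        1025 * L * M ^ 2 * √(d / n) < testLoss ℓ P W - trainLoss ℓ S W} ⊆
      {S | ∃ t : D, 1024 * (L * M ^ 2) * √(d / n) < ∫ z, excessLoss ℓ t.1.1 z ∂P -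
        (1 / (n : ℝ)) * ∑ i, excessLoss ℓ t.1.1 (S i)} ∪
      {S | L * M ^ 2 * √(d / n) < ∫ z, ℓ 0 z.2 ∂P - (1 / (n : ℝ)) * ∑ i, ℓ 0 (S i).2} := by
    rintro S ⟨W, hW, hlt⟩
    -- The strict inequality at `W` persists at some `V` in the dense set; there one of the two
    -- parts of the gap must exceed its share.
    obtain ⟨V, hV, hVD⟩ := hD.exists_mem_open
      (isOpen_Ioi.preimage (continuous_testLoss_sub_trainLoss hm hL h0 hP S)) ⟨⟨W, hW⟩, hlt⟩
    by_contra! hc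
    simp only [Set.mem_union, Set.mem_ofPred_eq, not_or, not_exists, not_lt] at hc
    have h1 := hc.1 ⟨V, ‹_›⟩
    have h2 := hc.2
    have h3 : 1025 * L * M ^ 2 * √(d / n) < testLoss ℓ P V.1 - trainLoss ℓ S V.1 := ‹_›
    rw [testLoss_sub_trainLoss_eq hm hL h0 hP S V.2] at h3
    linarith
  refine (measure_mono hsub).trans ((measure_union_le _ _).trans ?_)
  have h1 := measure_pi_excessLoss_deviation_le hd (le_of_mul_log_le hd hn hdn) hm hL hP hM0 hL0
    (fun t : D => t.1)
  have h2 := measure_pi_mean_deviation_le P ((hm 0).comp measurable_snd) hd hn hLM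
  refine (add_le_add h1 h2).trans ?_
  rw [mul_add, mul_one]
  refine add_le_add (ENNReal.div_le_div_right (by simp; norm_num) _) ?_
  rw [div_eq_mul_inv _ (d : ℝ≥0∞), mul_comm, ENNReal.div_eq_inv_mul (b := (d : ℝ≥0∞)), mul_assoc]
  gcongr
  exact le_mul_of_one_le_left zero_le (by simp)
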